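/- All graphs are finite and simple. For a graph $G$ with $m\ge 1$ edges and a partition $\mathcal A$ of its vertex set, let $$q_{\mathcal A}(G)=\frac1{2m}\sum_{A\in\mathcal A}\ \sum_{u,v\in A}\Big(\mathbf 1_{uv\in E(G)}-\frac{\deg(u)\deg(v)}{2m}\Big),$$ where $(u,v)$ ranges over all ordered pairs of (not necessarily distinct) vertices of $A$; if $G$ has no edges, let $q_{\mathcal A}(G)=1$. The modularity of $G$ is $q^*(G)=\max_{\mathcal A}q_{\mathcal A}(G)$, the maximum being over all partitions of the vertex set. For positive integers $r$ and $n$ such that $n\ge r+1$ and $rn$ is even (so that there are $r$-regular graphs on $n$ vertices), let $q_r^-(n)$ be the minimum of $q^*(G)$ over all $r$-regular graphs $G$ with $n$ vertices. **Theorem.** There is an absolute constant $c>0$ such that for every positive integer $r$ there is an $N=N(r)$ such that $$q_r^-(n)\ \ge\ \frac{c}{\sqrt r}\qquad\text{for all } n\ge N \text{ with } rn \text{ even}.$$ -/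

import Mathlib

noncomputable section

namespace GraphModularity

/-- The modularity score `q_𝒜(G)` of a partition `𝒜` of the vertex set of a finite graph `G` with
`m` edges:
`q_𝒜(G) = (1 / 2m) ∑_{A ∈ 𝒜} ∑_{u, v ∈ A} (1_{uv ∈ E} - deg(u) deg(v) / 2m)`,
where `u, v` range over ordered pairs (with `u = v` allowed).  A graph without edges has score `1`
for every partition. -/
def partitionModularity {V : Type*} [Fintype V] [DecidableEq V] (G : SimpleGraph V)
    [DecidableRel G.Adj] (P : Finpartition (Finset.univ : Finset V)) : ℝ :=
  if G.edgeFinset.card = 0 then 1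
  else
    1 / (2 * (G.edgeFinset.card : ℝ)) *
      ∑ A ∈ P.parts, ∑ u ∈ A, ∑ v ∈ A,
        ((if G.Adj u v then (1 : ℝ) else 0)
          - (G.degree u : ℝ) * (G.degree v : ℝ) / (2 * (G.edgeFinset.card : ℝ)))

/-- The modularity `q^*(G)`: the maximum of `q_𝒜(G)` over all partitions `𝒜` of the vertex set. -/
def modularity {V : Type*} [Fintype V] [DecidableEq V] (G : SimpleGraph V)
    [DecidableRel G.Adj] : ℝ :=
  (Finset.univ : Finset (Finpartition (Finset.univ : Finset V))).sup'
    ⟨⊥, Finset.mem_univ _⟩ (partitionModularity G)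

open scoped Classical in
/-- `𝒢(n, r)`: the set of all `r`-regular (simple) graphs on `n` labelled vertices. -/
def regularGraphs (n r : ℕ) : Set (SimpleGraph (Fin n)) :=
  {G | G.IsRegularOfDegree r}

open scoped Classical in
/-- `q_r^-(n)`: the minimum modularity over all `r`-regular graphs with `n` vertices.  The set is
finite, so that the infimum is a minimum as soon as an `r`-regular graph on `n` vertices exists, see
`isLeast_minModularity`.  (If there is none, the value is `0`.) -/
def minModularity (r n : ℕ) : ℝ :=
  sInf ((fun G : SimpleGraph (Fin n) => modularity G) '' regularGraphs n r)

open scoped Classical in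
theorem isLeast_minModularity {r n : ℕ} (h : (regularGraphs n r).Nonempty) :
    IsLeast ((fun G : SimpleGraph (Fin n) => modularity G) '' regularGraphs n r)
      (minModularity r n) :=
  have hfin : ((fun G : SimpleGraph (Fin n) => modularity G) '' regularGraphs n r).Finite :=
    (Set.toFinite (regularGraphs n r)).image _
  ⟨(h.image _).csInf_mem hfin, fun _ hx => csInf_le hfin.bddBelow hx⟩

end GraphModularity

end

namespace GraphModularity

open Finset

/-! Two-part partitions suffice. For regular `G` the score of `{S, Sᶜ}` is a normalised quadratic
form in the ±1 indicator of `S` (`modularity_ge_of_spin`), so signs are needed that correlate along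
edges and hardly at all globally. Give the vertices independent uniform signs and let `F v` be a
truncated weighted sum of the signs on the closed neighbourhood of `v`. Each `F v` is increasing and
has mean zero, so Harris' inequality, applied conditionally on the sign of `u`, bounds the
correlation of `F u` and `F v` below by the product of the influences of `u` (`correlation_ge`). For
an edge `uv` this is of order `1/√r`, whatever short cycles `G` has. Vertices without a common
closed neighbour are uncorrelated, so the term `-r/n` costs only `O(r³)` in total. Some outcome
attains the average, and its values in `[-1, 1]` are rounded to signs one coordinate at a time
(`exists_spin_quadratic_ge`). -/

/-- The sign of the vertex `v` in the two-colouring of `V` given by the set `x`. -/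
def spin {V : Type*} [DecidableEq V] (x : Finset V) (v : V) : ℝ := if v ∈ x then 1 else -1

/-- Truncation of a real number to the interval `[-1, 1]`. -/
def clip (t : ℝ) : ℝ := max (-1) (min 1 t)

lemma neg_one_le_clip (t : ℝ) : -1 ≤ clip t := le_max_left _ _

lemma clip_le_one (t : ℝ) : clip t ≤ 1 := max_le (by norm_num) (min_le_left _ _)

lemma clip_mono : Monotone clip := fun _ _ h => max_le_max le_rfl (min_le_min le_rfl h)

lemma clip_of_abs_le {t : ℝ} (h : |t| ≤ 1) : clip t = t := by
  rw [abs_le] at h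
  rw [clip, min_eq_right h.2, max_eq_right h.1]

lemma clip_neg (t : ℝ) : clip (-t) = -clip t := by
  simp only [clip, max_def, min_def]
  split_ifs <;> linarith

/-- For `|t| ≤ 3/4` no truncation occurs and the difference is `2h`; otherwise the left side is
nonpositive. The quadratic error lets a variance bound control the influence. -/
lemma clip_add_sub_clip_sub {t h : ℝ} (h0 : 0 ≤ h) (h1 : h ≤ 1 / 4) :
    2 * h * (1 - 2 * t ^ 2) ≤ clip (t + h) - clip (t - h) := by
  by_cases ht : |t| ≤ 3 / 4
  · rw [abs_le] at ht
    rw [clip_of_abs_le (abs_le.2 ⟨by linarith, by linarith⟩),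
      clip_of_abs_le (abs_le.2 ⟨by linarith, by linarith⟩)]
    nlinarith [mul_nonneg h0 (sq_nonneg t)]
  · have hm : clip (t - h) ≤ clip (t + h) := clip_mono (by linarith)
    have h2 : (3 / 4 : ℝ) ^ 2 ≤ t ^ 2 := by
      rw [← sq_abs t]
      exact pow_le_pow_left₀ (by norm_num) (le_of_not_ge ht) 2
    nlinarith [mul_nonneg h0 (by linarith : (0 : ℝ) ≤ t ^ 2 - (3 / 4) ^ 2)]

open scoped symmDiff

section Spin

variable {V : Type*} [DecidableEq V]

lemma spin_mul_self (x : Finset V) (v : V) : spin x v * spin x v = 1 := by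
  unfold spin; split_ifs <;> norm_num

lemma spin_symmDiff_of_mem (x : Finset V) {B : Finset V} {v : V} (h : v ∈ B) :
    spin (x ∆ B) v = -spin x v := by
  unfold spin; by_cases hx : v ∈ x <;> simp [mem_symmDiff, h, hx]

lemma spin_symmDiff_of_notMem (x : Finset V) {B : Finset V} {v : V} (h : v ∉ B) :
    spin (x ∆ B) v = spin x v := by
  unfold spin; by_cases hx : v ∈ x <;> simp [mem_symmDiff, h, hx]

lemma spin_monotone (v : V) : Monotone fun x : Finset V => spin x v := by
  intro x y hxy
  by_cases hx : v ∈ x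
  · simp [spin, hx, hxy hx]
  · by_cases hy : v ∈ y <;> simp [spin, hx, hy]

end Spin

/-! ### Harris' inequality, influences and truncated linear forms on the cube -/

section Cube

variable {V : Type*} [Fintype V] [DecidableEq V]

lemma sum_symmDiff (B : Finset V) (f : Finset V → ℝ) : ∑ x, f (x ∆ B) = ∑ x, f x :=
  Equiv.sum_comp (symmDiff_left_involutive B).toPerm f

lemma sum_eq_zero_of_symmDiff (B : Finset V) (f : Finset V → ℝ) (h : ∀ x, f (x ∆ B) = -f x) :
    ∑ x, f x = 0 := by
  have h1 := sum_symmDiff B f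
  simp only [h, sum_neg_distrib] at h1
  linarith

lemma sum_spin_mul_spin (u v : V) :
    ∑ x : Finset V, spin x u * spin x v = if u = v then (2 : ℝ) ^ Fintype.card V else 0 := by
  split_ifs with h
  · subst h
    simp [spin_mul_self]
  · refine sum_eq_zero_of_symmDiff {u} _ fun x => ?_
    rw [spin_symmDiff_of_mem x (mem_singleton_self u),
      spin_symmDiff_of_notMem x (by simpa using Ne.symm h)]
    ring

/-- Harris' inequality for two increasing functions on the cube, restricted to a sublattice. -/
lemma sum_filter_mul_sum_filter_le {f g : Finset V → ℝ} (hf : Monotone f) (hg : Monotone g)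
    (hf1 : ∀ x, -1 ≤ f x) (hg1 : ∀ x, -1 ≤ g x) (p : Finset V → Prop) [DecidablePred p]
    (hp : ∀ x y, p x → p y → p (x ⊓ y) ∧ p (x ⊔ y)) :
    (∑ x with p x, f x) * ∑ x with p x, g x
      ≤ #{x : Finset V | p x} * ∑ x with p x, f x * g x := by
  -- `fkg` asks for nonnegative functions, hence the shift by 1. The indicator of a sublattice is a
  -- log-supermodular weight.
  have key := fkg (μ := fun x : Finset V => if p x then (1 : ℝ) else 0)
    (f := fun x => f x + 1) (g := fun x => g x + 1)
    (fun x => by positivity)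
    (fun x => by simpa using by linarith [hf1 x]) (fun x => by simpa using by linarith [hg1 x])
    (fun x y h => by simpa using hf h) (fun x y h => by simpa using hg h)
    (fun a b => by
      by_cases ha : p a
      · by_cases hb : p b
        · simp only [ha, hb, (hp a b ha hb).1, (hp a b ha hb).2, if_true, le_refl]
        · simp only [hb]; simp; positivity
      · simp only [ha]; simp; positivity)
  simp only [ite_mul, one_mul, zero_mul, ← sum_filter] at key
  have e : ∀ x, (f x + 1) * (g x + 1) = f x * g x + f x + g x + 1 := fun x => by ring
  simp only [e, sum_add_distrib, sum_const, nsmul_eq_mul, mul_one] at key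
  nlinarith

lemma sum_spin_mul (u : V) (f : Finset V → ℝ) :
    ∑ x, spin x u * f x = (∑ x with u ∈ x, f x) - ∑ x with u ∉ x, f x := by
  rw [← sum_filter_add_sum_filter_not univ (fun x => u ∈ x), sub_eq_add_neg, ← sum_neg_distrib]
  congr 1 <;> refine sum_congr rfl fun x hx => ?_ <;> simp [spin, (mem_filter.1 hx).2]

lemma sum_spin (u : V) : ∑ x : Finset V, spin x u = 0 :=
  sum_eq_zero_of_symmDiff {u} _ fun x => spin_symmDiff_of_mem x (mem_singleton_self u)

/-- The correlation of two increasing functions on the cube is at least the product of their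
influences at any coordinate. -/
lemma correlation_ge {f g : Finset V → ℝ} (hf : Monotone f) (hg : Monotone g)
    (hf1 : ∀ x, -1 ≤ f x) (hg1 : ∀ x, -1 ≤ g x) (u : V) (hf0 : ∑ x, f x = 0) :
    (∑ x, spin x u * f x) * (∑ x, spin x u * g x)
      ≤ 2 ^ Fintype.card V * ∑ x, f x * g x := by
  have h1 := sum_filter_mul_sum_filter_le hf hg hf1 hg1 (fun x => u ∈ x)
    (fun x y hx hy => by simp [hx, hy])
  have h0 := sum_filter_mul_sum_filter_le hf hg hf1 hg1 (fun x => u ∉ x)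
    (fun x y hx hy => by simp [hx, hy])
  have hc : (#{x : Finset V | u ∈ x} : ℝ) + #{x : Finset V | u ∉ x} = 2 ^ Fintype.card V := by
    rw [← Nat.cast_add, card_filter_add_card_filter_not]
    simp
  have hd : (#{x : Finset V | u ∈ x} : ℝ) - #{x : Finset V | u ∉ x} = 0 := by
    have := sum_spin_mul u (fun _ => 1)
    simp only [mul_one, sum_spin, sum_const, nsmul_eq_mul] at this
    exact this.symm
  rw [sum_spin_mul, sum_spin_mul]
  have sf := sum_filter_add_sum_filter_not univ (fun x => u ∈ x) f
  have sfg := sum_filter_add_sum_filter_not univ (fun x => u ∈ x) (fun x => f x * g x)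
  rw [hf0] at sf
  rw [← sfg, ← hc]
  have e : (#{x : Finset V | u ∉ x} : ℝ) = #{x : Finset V | u ∈ x} := by linarith
  rw [e] at h0 ⊢
  -- As `f` has mean zero, its sums over the two half-cubes are opposite, so adding the two Harris
  -- inequalities leaves the difference of the sums of `g`, its influence.
  have e2 : ∑ x with u ∉ x, f x = -∑ x with u ∈ x, f x := by linarith
  rw [e2] at h0 ⊢
  nlinarith

/-- The truncated linear form with coefficients `w` on the cube. -/
def threshold (w : V → ℝ) (x : Finset V) : ℝ := clip (∑ v, w v * spin x v)

lemma threshold_monotone {w : V → ℝ} (hw : ∀ v, 0 ≤ w v) : Monotone (threshold w) :=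
  fun _ _ h => clip_mono (sum_le_sum fun v _ => mul_le_mul_of_nonneg_left (spin_monotone v h) (hw v))

lemma sum_linear_sq (w : V → ℝ) :
    ∑ x : Finset V, (∑ v, w v * spin x v) ^ 2 = 2 ^ Fintype.card V * ∑ v, w v ^ 2 := by
  simp only [sq, sum_mul_sum]
  rw [sum_comm, mul_sum]
  refine sum_congr rfl fun u _ => ?_
  rw [sum_comm]
  have : ∀ v, ∑ x : Finset V, w u * spin x u * (w v * spin x v)
      = w u * w v * ∑ x : Finset V, spin x u * spin x v := fun v => by
    rw [mul_sum]; exact sum_congr rfl fun x _ => by ring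
  simp only [this, sum_spin_mul_spin]
  simp
  ring

lemma threshold_symmDiff_eq_neg {w : V → ℝ} {B : Finset V} (h : ∀ v, v ∉ B → w v = 0)
    (x : Finset V) : threshold w (x ∆ B) = -threshold w x := by
  rw [threshold, threshold, ← clip_neg, ← sum_neg_distrib]
  congr 1
  refine sum_congr rfl fun v _ => ?_
  by_cases hv : v ∈ B
  · rw [spin_symmDiff_of_mem x hv]; ring
  · simp [h v hv]

lemma threshold_symmDiff_eq_self {w : V → ℝ} {B : Finset V} (h : ∀ v, v ∈ B → w v = 0)
    (x : Finset V) : threshold w (x ∆ B) = threshold w x := by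
  rw [threshold, threshold]
  congr 1
  refine sum_congr rfl fun v _ => ?_
  by_cases hv : v ∈ B
  · simp [h v hv]
  · rw [spin_symmDiff_of_notMem x hv]

lemma sum_threshold (w : V → ℝ) : ∑ x, threshold w x = 0 :=
  sum_eq_zero_of_symmDiff univ _ fun x => threshold_symmDiff_eq_neg (by simp) x

/-- Flipping all signs in the support of `w` negates the first factor and fixes the second. -/
lemma sum_threshold_mul_threshold_eq_zero {w w' : V → ℝ} (h : ∀ v, w v = 0 ∨ w' v = 0) :
    ∑ x, threshold w x * threshold w' x = 0 := by
  refine sum_eq_zero_of_symmDiff {v | w v ≠ 0} _ fun x => ?_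
  rw [threshold_symmDiff_eq_neg (by simp), threshold_symmDiff_eq_self, neg_mul]
  intro v hv
  exact (h v).resolve_left (mem_filter.1 hv).2

/-- Pair `x` with its flip at `u`: the rest of the form is the argument `t` of
`clip_add_sub_clip_sub`, and its second moment is at most `1/8`, whence `3/4 = 1 - 2/8`. -/
lemma influence_threshold_ge {w : V → ℝ} {u : V} (h0 : 0 ≤ w u) (h1 : w u ≤ 1 / 4)
    (hw : ∑ v, w v ^ 2 ≤ 1 / 8) :
    2 ^ Fintype.card V * (3 / 4 * w u) ≤ ∑ x, spin x u * threshold w x := by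
  set w' : V → ℝ := Function.update w u 0 with hw'
  have hw'2 : ∑ v, w' v ^ 2 ≤ 1 / 8 := by
    refine le_trans (sum_le_sum fun v _ => ?_) hw
    by_cases hv : v = u
    · subst hv; simp [hw', sq_nonneg]
    · simp [hw', hv]
  have hL : ∀ x : Finset V,
      ∑ v, w v * spin x v = (∑ v, w' v * spin x v) + w u * spin x u := fun x => by
    rw [← add_sum_erase _ _ (mem_univ u), ← add_sum_erase univ (fun v => w' v * _) (mem_univ u)]
    have : ∑ v ∈ univ.erase u, w' v * spin x v = ∑ v ∈ univ.erase u, w v * spin x v :=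
      sum_congr rfl fun v hv => by simp [hw', (mem_erase.1 hv).1]
    rw [this]
    simp [hw', add_comm]
  have hL' : ∀ x : Finset V, ∑ v, w' v * spin (x ∆ {u}) v = ∑ v, w' v * spin x v := fun x => by
    refine sum_congr rfl fun v _ => ?_
    by_cases hv : v = u
    · subst hv; simp [hw']
    · rw [spin_symmDiff_of_notMem x (by simpa using hv)]
  have key : ∀ x : Finset V, 2 * w u * (1 - 2 * (∑ v, w' v * spin x v) ^ 2)
      ≤ spin x u * threshold w x + spin (x ∆ {u}) u * threshold w (x ∆ {u}) := fun x => by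
    rw [threshold, threshold, hL, hL, hL', spin_symmDiff_of_mem x (mem_singleton_self u)]
    have := clip_add_sub_clip_sub (t := ∑ v, w' v * spin x v) h0 h1
    by_cases hx : u ∈ x
    · have hs : spin x u = 1 := by simp [spin, hx]
      rw [hs]
      ring_nf at this ⊢
      exact this
    · have hs : spin x u = -1 := by simp [spin, hx]
      rw [hs]
      ring_nf at this ⊢
      linarith
  have hs := sum_le_sum fun x (_ : x ∈ (univ : Finset (Finset V))) => key x
  rw [sum_add_distrib, sum_symmDiff {u} (fun x => spin x u * threshold w x), ← mul_sum,
    sum_sub_distrib, ← mul_sum, sum_linear_sq] at hs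
  simp only [sum_const, card_univ, Fintype.card_finset, nsmul_eq_mul, Nat.cast_pow, Nat.cast_ofNat,
    mul_one] at hs
  have hp : (0 : ℝ) < 2 ^ Fintype.card V := by positivity
  have := mul_nonneg (mul_nonneg hp.le h0) (sub_nonneg.2 hw'2)
  nlinarith

end Cube

/-! ### Rounding values in `[-1, 1]` to signs -/

section Rounding

variable {V : Type*} [Fintype V] [DecidableEq V]

/-- With zero diagonal the form is affine in each coordinate, so it does not decrease on moving to a
suitable endpoint. -/
lemma exists_update_quadratic_ge {M : V → V → ℝ} (hM : ∀ v, M v v = 0) {z : V → ℝ}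
    (a : V) (hz : |z a| ≤ 1) :
    ∃ t : ℝ, (t = 1 ∨ t = -1) ∧ ∑ u, ∑ v, M u v * (z u * z v)
      ≤ ∑ u, ∑ v, M u v * (Function.update z a t u * Function.update z a t v) := by
  set y := Function.update z a 0 with hy
  obtain ⟨P, Q, hPQ⟩ : ∃ P Q : ℝ, ∀ t, ∑ u, ∑ v, M u v *
      (Function.update z a t u * Function.update z a t v) = P + t * Q := by
    refine ⟨∑ u, ∑ v, M u v * (y u * y v),
      ∑ u, ∑ v, M u v * (y u * (if v = a then 1 else 0) + (if u = a then 1 else 0) * y v),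
      fun t => ?_⟩
    rw [mul_sum, ← sum_add_distrib]
    refine sum_congr rfl fun u _ => ?_
    rw [mul_sum, ← sum_add_distrib]
    refine sum_congr rfl fun v _ => ?_
    by_cases hu : u = a <;> by_cases hv : v = a
    · simp [hu, hv, hM]
    · simp [hu, hv, hy]; ring
    · simp [hu, hv, hy]; ring
    · simp [hu, hv, hy]
  have h0 := hPQ (z a)
  rw [Function.update_eq_self] at h0
  rw [abs_le] at hz
  rcases le_total 0 Q with hQ | hQ
  · exact ⟨1, Or.inl rfl, by rw [h0, hPQ]; nlinarith⟩
  · exact ⟨-1, Or.inr rfl, by rw [h0, hPQ]; nlinarith⟩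

lemma exists_spin_quadratic_ge_of_diag_eq_zero {M : V → V → ℝ} (hM : ∀ v, M v v = 0) {y : V → ℝ}
    (hy : ∀ v, |y v| ≤ 1) :
    ∃ S : Finset V, ∑ u, ∑ v, M u v * (y u * y v)
      ≤ ∑ u, ∑ v, M u v * (spin S u * spin S v) := by
  have key : ∀ T : Finset V, ∃ z : V → ℝ, (∀ v, |z v| ≤ 1) ∧ (∀ v ∈ T, z v = 1 ∨ z v = -1) ∧
      ∑ u, ∑ v, M u v * (y u * y v) ≤ ∑ u, ∑ v, M u v * (z u * z v) := by
    intro T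
    induction T using Finset.induction_on with
    | empty => exact ⟨y, hy, by simp, le_rfl⟩
    | insert a T _ ih =>
      obtain ⟨z, hz, hT, hle⟩ := ih
      obtain ⟨t, ht, hle'⟩ := exists_update_quadratic_ge hM a (hz a)
      refine ⟨Function.update z a t, fun v => ?_, fun v hv => ?_, hle.trans hle'⟩
      · by_cases hva : v = a
        · subst hva; rcases ht with rfl | rfl <;> simp
        · simpa [hva] using hz v
      · by_cases hva : v = a
        · subst hva; simpa using ht
        · simpa [hva] using hT v ((mem_insert.1 hv).resolve_left hva)
  obtain ⟨z, -, hz, hle⟩ := key univ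
  refine ⟨univ.filter fun v => z v = 1, ?_⟩
  have : spin (univ.filter fun v => z v = 1) = z := by
    ext v
    rcases hz v (mem_univ v) with h | h <;> simp [spin, h]
    norm_num
  rwa [this]

lemma exists_spin_quadratic_ge {M : V → V → ℝ} (hM : ∀ v, M v v ≤ 0) {y : V → ℝ}
    (hy : ∀ v, |y v| ≤ 1) :
    ∃ S : Finset V, (∑ u, ∑ v, M u v * (y u * y v)) + ∑ v, M v v
      ≤ ∑ u, ∑ v, M u v * (spin S u * spin S v) := by
  obtain ⟨S, hS⟩ := exists_spin_quadratic_ge_of_diag_eq_zero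
    (M := fun u v => if u = v then 0 else M u v) (by simp) hy
  refine ⟨S, ?_⟩
  have e : ∀ z : V → ℝ, ∑ u, ∑ v, M u v * (z u * z v)
      = (∑ u, ∑ v, (if u = v then 0 else M u v) * (z u * z v)) + ∑ v, M v v * (z v * z v) := by
    intro z
    rw [← sum_add_distrib]
    refine sum_congr rfl fun u _ => ?_
    have : M u u * (z u * z u) = ∑ v, if u = v then M u v * (z u * z v) else 0 := by simp
    rw [this, ← sum_add_distrib]
    refine sum_congr rfl fun v _ => ?_
    split_ifs <;> simp
  rw [e, e (spin S)]
  have h1 : ∑ v, M v v * (y v * y v) ≤ 0 :=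
    sum_nonpos fun v _ => mul_nonpos_of_nonpos_of_nonneg (hM v) (mul_self_nonneg _)
  simp only [spin_mul_self, mul_one]
  linarith

end Rounding

/-! ### Modularity of a bipartition of a regular graph -/

open scoped Classical in
lemma two_mul_card_edgeFinset {V : Type*} [Fintype V] {G : SimpleGraph V} {r : ℕ}
    (hG : G.IsRegularOfDegree r) : 2 * (#G.edgeFinset : ℝ) = r * Fintype.card V := by
  have h := G.sum_degrees_eq_twice_card_edges
  simp only [hG.degree_eq, sum_const, card_univ, smul_eq_mul] at h
  rw [mul_comm (r : ℝ)]
  exact_mod_cast h.symm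

open scoped Classical in
lemma modularity_ge_of_spin {V : Type*} [Fintype V] [DecidableEq V] [Nonempty V]
    {G : SimpleGraph V} {r : ℕ} (hr : 0 < r) (hG : G.IsRegularOfDegree r) (S : Finset V) :
    1 / (2 * (r * Fintype.card V)) *
      ∑ u, ∑ v, ((if G.Adj u v then (1 : ℝ) else 0) - r / Fintype.card V) * (spin S u * spin S v)
      ≤ modularity G := by
  have hm := two_mul_card_edgeFinset hG
  have hV : (0 : ℝ) < Fintype.card V := by exact_mod_cast Fintype.card_pos
  have hr' : (0 : ℝ) < r := by exact_mod_cast hr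
  have hdisj : Disjoint S Sᶜ := disjoint_compl_right
  have hSne : S ≠ Sᶜ := by
    intro h
    rw [← h, disjoint_self] at hdisj
    rw [hdisj] at h
    simp at h
    exact univ_nonempty.ne_empty h.symm
  let P : Finpartition (univ : Finset V) := Finpartition.ofErase {S, Sᶜ}
    ((supIndep_pair hSne).2 hdisj) (by simp)
  refine le_trans (le_of_eq ?_) (le_sup' (partitionModularity G) (mem_univ P))
  have hne : #G.edgeFinset ≠ 0 := by
    intro h
    rw [h, Nat.cast_zero, mul_zero] at hm
    exact (mul_pos hr' hV).ne hm
  set h : V → V → ℝ := fun u v => (if G.Adj u v then (1 : ℝ) else 0) - r / Fintype.card V with hh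
  rw [partitionModularity, if_neg hne, hm]
  have e : ∀ u v, (if G.Adj u v then (1 : ℝ) else 0)
      - (G.degree u : ℝ) * (G.degree v : ℝ) / (r * Fintype.card V) = h u v := fun u v => by
    rw [hG.degree_eq, hG.degree_eq, hh]
    field_simp
  simp only [e]
  -- If `S` is empty or everything, one part is erased from the partition; the empty part
  -- contributes zero.
  change _ = _ * ∑ A ∈ ({S, Sᶜ} : Finset (Finset V)).erase ∅, ∑ u ∈ A, ∑ v ∈ A, h u v
  rw [sum_erase _ (by simp), sum_pair hSne]
  -- Zero row sums make the spin form exactly twice the sum within the parts.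
  have hrow : ∀ u, ∑ v, h u v = 0 := fun u => by
    simp only [hh, sum_sub_distrib, sum_boole, sum_const, card_univ, nsmul_eq_mul]
    have : #{v | G.Adj u v} = r := by
      rw [← hG u, ← G.card_neighborFinset_eq_degree, G.neighborFinset_eq_filter]
    rw [this]
    field_simp
    ring
  have hS : ∀ T : Finset V, ∑ u ∈ T, ∑ v ∈ T, h u v
      = ∑ u, ∑ v, if u ∈ T then if v ∈ T then h u v else 0 else 0 := fun T => by
    rw [← sum_filter_add_sum_filter_not univ (fun u => u ∈ T)
      (fun u => ∑ v, if u ∈ T then if v ∈ T then h u v else 0 else 0),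
      sum_eq_zero (s := univ.filter fun u => u ∉ T) fun u hu => by simp [(mem_filter.1 hu).2],
      add_zero, filter_univ_mem]
    refine sum_congr rfl fun u hu => ?_
    simp [hu]
  have hpair : ∀ u v, h u v * (spin S u * spin S v)
      = 2 * ((if u ∈ S then if v ∈ S then h u v else 0 else 0)
        + (if u ∈ Sᶜ then if v ∈ Sᶜ then h u v else 0 else 0)) - h u v := fun u v => by
    by_cases hu : u ∈ S <;> by_cases hv : v ∈ S <;> simp [spin, hu, hv] <;> ring
  have htot : ∑ u, ∑ v, h u v * (spin S u * spin S v)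
      = 2 * (∑ u ∈ S, ∑ v ∈ S, h u v + ∑ u ∈ Sᶜ, ∑ v ∈ Sᶜ, h u v) := by
    simp only [hpair, sum_sub_distrib, hrow, ← mul_sum, sum_add_distrib, hS, sub_zero]
  rw [htot]
  field_simp

/-! ### Local forms on a regular graph and their correlations -/

open scoped Classical in
/-- The weights of the linear form at `v`: `1 / 4` at `v` itself and `1 / (4 √r)` at its
neighbours. -/
noncomputable def localWeight {V : Type*} (G : SimpleGraph V) (r : ℕ) (v w : V) : ℝ :=
  if w = v then 1 / 4 else if G.Adj v w then 1 / (4 * √r) else 0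

lemma localWeight_nonneg {V : Type*} (G : SimpleGraph V) (r : ℕ) (v w : V) :
    0 ≤ localWeight G r v w := by
  unfold localWeight; split_ifs <;> positivity

section LocalWeight

open scoped Classical

variable {V : Type*} [Fintype V] {G : SimpleGraph V} {r : ℕ}

lemma sum_localWeight_sq (hr : 0 < r) (hG : G.IsRegularOfDegree r) (v : V) :
    ∑ w, localWeight G r v w ^ 2 = 1 / 8 := by
  have hr' : (0 : ℝ) < r := by exact_mod_cast hr
  have e : ∀ w, localWeight G r v w ^ 2
      = (if w = v then 1 / 16 else 0) + if G.Adj v w then 1 / (16 * (r : ℝ)) else 0 := fun w => by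
    unfold localWeight
    by_cases h : w = v
    · subst h; simp; norm_num
    · by_cases h2 : G.Adj v w <;> simp [h, h2, mul_pow]
      norm_num
  have hc : #{w | G.Adj v w} = r := by
    rw [← hG v, ← G.card_neighborFinset_eq_degree, G.neighborFinset_eq_filter]
  simp only [e, sum_add_distrib]
  rw [← sum_filter (fun w => G.Adj v w), sum_const, hc]
  simp
  field_simp
  norm_num

lemma sum_threshold_mul_threshold_ge_of_adj (hr : 0 < r) (hG : G.IsRegularOfDegree r) {u v : V}
    (huv : G.Adj u v) :
    2 ^ Fintype.card V * (9 / (256 * √r))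
      ≤ ∑ x, threshold (localWeight G r u) x * threshold (localWeight G r v) x := by
  have hs : 1 ≤ √(r : ℝ) := Real.one_le_sqrt.2 (by exact_mod_cast hr)
  have hu : localWeight G r u u = 1 / 4 := by simp [localWeight]
  have hv : localWeight G r v u = 1 / (4 * √r) := by
    simp [localWeight, huv.ne, huv.symm]
  have h1 := influence_threshold_ge (u := u) (localWeight_nonneg G r u u) hu.le
    (sum_localWeight_sq hr hG u).le
  have h2 := influence_threshold_ge (u := u) (localWeight_nonneg G r v u)
    (by rw [hv]; exact one_div_le_one_div_of_le (by norm_num) (by linarith))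
    (sum_localWeight_sq hr hG v).le
  have h3 := correlation_ge (threshold_monotone (localWeight_nonneg G r u))
    (threshold_monotone (localWeight_nonneg G r v)) (fun _ => neg_one_le_clip _)
    (fun _ => neg_one_le_clip _) u (sum_threshold _)
  have h4 := mul_le_mul h1 h2 (by rw [hv]; positivity) (le_trans (by rw [hu]; positivity) h1)
  have hp : (0 : ℝ) < 2 ^ Fintype.card V := by positivity
  refine le_of_mul_le_mul_left ((le_of_eq ?_).trans (h4.trans h3)) hp
  rw [hu, hv]
  field_simp
  norm_num

lemma sum_threshold_mul_threshold_le (w w' : V → ℝ) :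
    ∑ x, threshold w x * threshold w' x ≤ 2 ^ Fintype.card V := by
  calc ∑ x, threshold w x * threshold w' x ≤ ∑ _x : Finset V, (1 : ℝ) := by
        refine sum_le_sum fun x _ => ?_
        have h1 := neg_one_le_clip (∑ v, w v * spin x v)
        have h2 := clip_le_one (∑ v, w v * spin x v)
        have h3 := neg_one_le_clip (∑ v, w' v * spin x v)
        have h4 := clip_le_one (∑ v, w' v * spin x v)
        unfold threshold
        nlinarith
    _ = 2 ^ Fintype.card V := by simp

lemma sum_sum_threshold_mul_threshold_le (hG : G.IsRegularOfDegree r) :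
    ∑ u, ∑ v, ∑ x, threshold (localWeight G r u) x * threshold (localWeight G r v) x
      ≤ Fintype.card V * (r + 1) ^ 2 * 2 ^ Fintype.card V := by
  -- Only vertices within distance two, at most `(r + 1)²` of them, can be correlated with `u`.
  set N : V → Finset V := fun v => insert v (G.neighborFinset v) with hN
  have hcard : ∀ v, #(N v) ≤ r + 1 := fun v => by
    refine (card_insert_le _ _).trans ?_
    rw [G.card_neighborFinset_eq_degree, hG v]
  have hsupp : ∀ v w, localWeight G r v w ≠ 0 → w ∈ N v := fun v w h => by
    by_contra hw
    simp only [hN, mem_insert, SimpleGraph.mem_neighborFinset, not_or] at hw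
    exact h (by simp [localWeight, hw.1, hw.2])
  have hsymm : ∀ v w, w ∈ N v → v ∈ N w := fun v w h => by
    simp only [hN, mem_insert, SimpleGraph.mem_neighborFinset] at h ⊢
    exact h.imp Eq.symm fun h => h.symm
  have hrow : ∀ u, ∑ v, ∑ x, threshold (localWeight G r u) x * threshold (localWeight G r v) x
      ≤ (r + 1) ^ 2 * 2 ^ Fintype.card V := fun u => by
    have hsub := sum_subset (subset_univ ((N u).biUnion N))
      (f := fun v => ∑ x, threshold (localWeight G r u) x * threshold (localWeight G r v) x)
      fun v _ hv => sum_threshold_mul_threshold_eq_zero fun w => by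
        by_contra hw
        rw [not_or] at hw
        exact hv (mem_biUnion.2 ⟨w, hsupp _ _ hw.1, hsymm _ _ (hsupp _ _ hw.2)⟩)
    rw [← hsub]
    refine (sum_le_card_nsmul _ _ _ fun v _ => sum_threshold_mul_threshold_le _ _).trans ?_
    rw [nsmul_eq_mul]
    gcongr
    have : #((N u).biUnion N) ≤ (r + 1) ^ 2 :=
      (card_biUnion_le_card_mul _ _ _ fun v _ => hcard v).trans (by
        rw [sq]; exact Nat.mul_le_mul_right _ (hcard u))
    exact_mod_cast this
  refine (sum_le_card_nsmul _ _ _ fun u _ => hrow u).trans ?_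
  rw [nsmul_eq_mul, card_univ, mul_assoc]

end LocalWeight

open scoped Classical in
lemma exists_spin_adj_sum_ge {V : Type*} [Fintype V] [Nonempty V] {G : SimpleGraph V} {r : ℕ}
    (hr : 0 < r) (hG : G.IsRegularOfDegree r) :
    ∃ S : Finset V, r * Fintype.card V * (9 / (256 * √r)) - r * (r + 1) ^ 2 - r
      ≤ ∑ u, ∑ v, ((if G.Adj u v then (1 : ℝ) else 0) - r / Fintype.card V)
        * (spin S u * spin S v) := by
  have hV : (0 : ℝ) < Fintype.card V := by exact_mod_cast Fintype.card_pos
  set F : V → Finset V → ℝ := fun v => threshold (localWeight G r v) with hF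
  set M : V → V → ℝ := fun u v => (if G.Adj u v then (1 : ℝ) else 0) - r / Fintype.card V with hM
  have hMd : ∀ v, M v v = -(r / Fintype.card V) := fun v => by simp [hM]
  have hadj : (r * Fintype.card V : ℝ) * (2 ^ Fintype.card V * (9 / (256 * √r)))
      ≤ ∑ u, ∑ v, (if G.Adj u v then (1 : ℝ) else 0) * ∑ x, F u x * F v x := by
    have hrow : ∀ u, (r : ℝ) * (2 ^ Fintype.card V * (9 / (256 * √r)))
        ≤ ∑ v, (if G.Adj u v then (1 : ℝ) else 0) * ∑ x, F u x * F v x := fun u => by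
      have hc : #{w | G.Adj u w} = r := by
        rw [← hG u, ← G.card_neighborFinset_eq_degree, G.neighborFinset_eq_filter]
      simp only [ite_mul, one_mul, zero_mul, ← sum_filter]
      refine le_trans (le_of_eq ?_) (card_nsmul_le_sum _ _ _ fun v hv =>
        sum_threshold_mul_threshold_ge_of_adj hr hG (mem_filter.1 hv).2)
      rw [hc, nsmul_eq_mul]
    refine le_trans (le_of_eq ?_) (card_nsmul_le_sum _ _ _ fun u _ => hrow u)
    rw [nsmul_eq_mul, card_univ]
    ring
  have hswap : ∑ x, ∑ u, ∑ v, M u v * (F u x * F v x)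
      = (∑ u, ∑ v, (if G.Adj u v then (1 : ℝ) else 0) * ∑ x, F u x * F v x)
        - r / Fintype.card V * ∑ u, ∑ v, ∑ x, F u x * F v x := by
    rw [sum_comm, mul_sum, ← sum_sub_distrib]
    refine sum_congr rfl fun u _ => ?_
    rw [sum_comm, mul_sum, ← sum_sub_distrib]
    refine sum_congr rfl fun v _ => ?_
    rw [← mul_sum, ← sub_mul]
  have hle := mul_le_mul_of_nonneg_left (sum_sum_threshold_mul_threshold_le hG)
    (by positivity : (0 : ℝ) ≤ r / Fintype.card V)
  obtain ⟨x, -, hx⟩ := exists_le_of_sum_le (s := (univ : Finset (Finset V))) univ_nonempty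
    (f := fun _ => (r * Fintype.card V : ℝ) * (9 / (256 * √r)) - r * (r + 1) ^ 2)
    (g := fun x => ∑ u, ∑ v, M u v * (F u x * F v x)) (by
      rw [hswap, sum_const, card_univ, Fintype.card_finset, nsmul_eq_mul]
      have e : (r / Fintype.card V : ℝ) * (Fintype.card V * (r + 1) ^ 2 * 2 ^ Fintype.card V)
          = r * (r + 1) ^ 2 * 2 ^ Fintype.card V := by field_simp
      rw [e] at hle
      push_cast
      linarith)
  obtain ⟨S, hS⟩ := exists_spin_quadratic_ge (M := M) (y := fun v => F v x)
    (fun v => by rw [hMd]; exact neg_nonpos.2 (by positivity))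
    (fun v => abs_le.2 ⟨neg_one_le_clip _, clip_le_one _⟩)
  refine ⟨S, le_trans ?_ hS⟩
  have hd : ∑ v, M v v = -r := by
    simp only [hMd, sum_const, card_univ, nsmul_eq_mul]
    field_simp
  rw [hd]
  linarith

/-! ### Existence of regular graphs, without which `minModularity` would be an infimum over the
empty set -/

lemma circulantGraph_isRegularOfDegree {A : Type*} [AddCommGroup A] (s : Finset A)
    [(SimpleGraph.circulantGraph (s : Set A)).LocallyFinite]
    (h0 : (0 : A) ∉ s) (hs : ∀ a ∈ s, -a ∈ s) :
    (SimpleGraph.circulantGraph (s : Set A)).IsRegularOfDegree #s := by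
  intro v
  rw [← SimpleGraph.card_neighborFinset_eq_degree]
  have : (SimpleGraph.circulantGraph (s : Set A)).neighborFinset v
      = s.map (addLeftEmbedding v) := by
    ext w
    rw [SimpleGraph.mem_neighborFinset, SimpleGraph.circulantGraph, SimpleGraph.fromRel_adj]
    simp only [mem_coe, mem_map, addLeftEmbedding_apply]
    constructor
    · rintro ⟨-, h | h⟩
      · exact ⟨w - v, by simpa using hs _ h, by abel⟩
      · exact ⟨w - v, h, by abel⟩
    · rintro ⟨a, ha, rfl⟩
      refine ⟨fun h => h0 ?_, Or.inr (by simpa using ha)⟩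
      rwa [← left_eq_add.1 h]
  rw [this, card_map]

/-- A set of `r` nonzero residues modulo `n` that is closed under negation. -/
lemma exists_symmetric_finset {n r : ℕ} [NeZero n] (hn : r < n) (he : Even (r * n)) :
    ∃ s : Finset (Fin n), 0 ∉ s ∧ (∀ a ∈ s, -a ∈ s) ∧ #s = r := by
  have hodd : r % 2 = 1 → n % 2 = 0 := fun h => by
    rcases Nat.even_mul.1 he with h' | h'
    · have := Nat.even_iff.1 h'; omega
    · exact Nat.even_iff.1 h'
  -- The residues `±1, …, ±⌊r/2⌋`, and for odd `r` (so even `n`) also the self-inverse `n/2`.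
  set t : Finset ℕ := Ioc 0 (r / 2) ∪ Ico (n - r / 2) n ∪ if r % 2 = 1 then {n / 2} else ∅ with ht
  have hmem : ∀ i, i ∈ t ↔ (0 < i ∧ i ≤ r / 2) ∨ (n - r / 2 ≤ i ∧ i < n) ∨
      (r % 2 = 1 ∧ i = n / 2) := fun i => by
    rw [ht, mem_union, mem_union, mem_Ioc, mem_Ico, or_assoc]
    split_ifs with h <;> simp [h]
  have hlt : ∀ i ∈ t, i < n := fun i hi => by rw [hmem] at hi; omega
  refine ⟨t.attachFin hlt, ?_, fun a ha => ?_, ?_⟩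
  · rw [mem_attachFin, hmem, Fin.val_zero]
    omega
  · rw [mem_attachFin, hmem] at ha ⊢
    have hn' := a.2
    rw [Fin.neg_def]
    simp only
    rw [Nat.mod_eq_of_lt (by omega)]
    omega
  · rw [card_attachFin, ht, card_union_of_disjoint, card_union_of_disjoint, Nat.card_Ioc,
      Nat.card_Ico]
    · split_ifs with h <;> simp <;> omega
    · rw [disjoint_left]
      intro i hi hi'
      rw [mem_Ioc] at hi
      rw [mem_Ico] at hi'
      omega
    · split_ifs with h
      · rw [disjoint_singleton_right, mem_union, mem_Ioc, mem_Ico]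
        have := hodd h
        omega
      · exact disjoint_empty_right _

open scoped Classical in
lemma regularGraphs_nonempty {n r : ℕ} (hn : r < n) (he : Even (r * n)) :
    (regularGraphs n r).Nonempty := by
  have : NeZero n := ⟨by omega⟩
  obtain ⟨s, h0, hs, hc⟩ := exists_symmetric_finset hn he
  subst hc
  exact ⟨SimpleGraph.circulantGraph (s : Set (Fin n)), by
    rw [regularGraphs, Set.mem_ofPred_eq]
    convert circulantGraph_isRegularOfDegree s h0 hs⟩

open scoped Classical in
lemma modularity_ge_of_isRegularOfDegree {V : Type*} [Fintype V] [DecidableEq V] {G : SimpleGraph V}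
    {r : ℕ} (hr : 0 < r) (hG : G.IsRegularOfDegree r)
    (hn : 64 * r * ((r + 1) ^ 2 + 1) ≤ Fintype.card V) :
    1 / 128 / √r ≤ modularity G := by
  have hpos : 0 < Fintype.card V := lt_of_lt_of_le (by positivity) hn
  have : Nonempty V := Fintype.card_pos_iff.1 hpos
  have hV : (0 : ℝ) < Fintype.card V := by exact_mod_cast hpos
  have hr' : (1 : ℝ) ≤ r := by exact_mod_cast hr
  obtain ⟨S, hS⟩ := exists_spin_adj_sum_ge hr hG
  refine le_trans ?_ (modularity_ge_of_spin hr hG S)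
  have hS' : r * Fintype.card V * (9 / (256 * √r)) - r * (r + 1) ^ 2 - r
      ≤ ∑ u, ∑ v, ((if G.Adj u v then (1 : ℝ) else 0) - r / Fintype.card V)
        * (spin S u * spin S v) := by
    convert hS
  refine le_trans ?_ (mul_le_mul_of_nonneg_left hS' (by positivity))
  have hs : 1 ≤ √(r : ℝ) := Real.one_le_sqrt.2 hr'
  have hsr : √(r : ℝ) ≤ r := Real.sqrt_le_iff.2 ⟨by linarith, by nlinarith⟩
  have hn' : 64 * (r : ℝ) * ((r + 1) ^ 2 + 1) ≤ Fintype.card V := by exact_mod_cast hn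
  have h1 : 64 * √(r : ℝ) * ((r + 1) ^ 2 + 1) ≤ Fintype.card V :=
    le_trans (by gcongr) hn'
  have e : 1 / (2 * (r * Fintype.card V : ℝ))
        * (r * Fintype.card V * (9 / (256 * √r)) - r * (r + 1) ^ 2 - r)
      = 9 / 512 / √r - ((r + 1) ^ 2 + 1) / (2 * Fintype.card V) := by
    field_simp
    ring
  -- The threshold on `n` makes the error at most `4/512` of `1/√r`, against a main term `9/512`.
  have h2 : ((r + 1) ^ 2 + 1 : ℝ) / (2 * Fintype.card V) ≤ 1 / 128 / √r := by
    rw [div_div, div_le_div_iff₀ (by positivity) (by positivity)]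
    linarith
  have h3 : (9 / 512 / √r : ℝ) = 2 * (1 / 128 / √r) + 1 / 512 / √r := by ring
  have h4 : (0 : ℝ) ≤ 1 / 512 / √r := by positivity
  rw [e]
  linarith

end GraphModularity

theorem mainTheorem4 :
    ∃ c : ℝ, 0 < c ∧ ∀ r : ℕ, 0 < r →
      ∃ N : ℕ, ∀ n : ℕ, N ≤ n → Even (r * n) →
        c / Real.sqrt (r : ℝ) ≤ GraphModularity.minModularity r n := by
  refine ⟨1 / 128, by norm_num, fun r hr => ⟨64 * r * ((r + 1) ^ 2 + 1), fun n hn he => ?_⟩⟩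
  have hrn : r < n := lt_of_lt_of_le (by nlinarith [Nat.zero_le (r * (r + 1) ^ 2)]) hn
  obtain ⟨G, hG, hGm⟩ :=
    (GraphModularity.isLeast_minModularity (GraphModularity.regularGraphs_nonempty hrn he)).1
  rw [← hGm]
  exact GraphModularity.modularity_ge_of_isRegularOfDegree hr hG (by simpa using hn)
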